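/- Consider stochastic multi-armed bandits. A bandit instance $\nu=(\nu_1,\dots,\nu_K)$ consists of $K$ reward distributions on $\mathbb{R}$ with means $\mu_1,\dots,\mu_K$. The rewards $X^i_1,X^i_2,\dots$ of each arm $i$ are i.i.d. with law $\nu_i$, and independent across arms. A bandit algorithm with horizon $T$ draws, in each round $t\le T$, an arm $A_t\sim\pi_t(\cdot\mid A_1,r_1,\dots,A_{t-1},r_{t-1})$ and collects the reward $r_t=X^{A_t}_{N_{A_t,t}}$, where $N_{i,t}=\#\{s\le t: A_s=i\}$; the decision rules $\pi_t$ may depend on $K$ and on $T$. Let $$R_T(\nu)=\sum_{i=1}^K\Big(\max_{j}\mu_j-\mu_i\Big)\,\mathbb{E}[N_{i,T}],\qquad S_T(\nu)=\max_{1\le i\le K}\sqrt{\operatorname{Var}(N_{i,T})}$$ be the regret and the allocation variability. Fix $M,\sigma>0$ and an integer $\bar K\ge 2$, and let $\mathfrak{P}$ be the class of all instances with $2\le K\le\bar K$ arms such that every $\nu_i$ has mean $\mu_i\in[-M,M]$ and is $\sigma$-sub-Gaussian, i.e. $\int e^{u(x-\mu_i)}\,\nu_i(dx)\le e^{\sigma^2u^2/2}$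 for all $u\in\mathbb{R}$. Let $\mathcal{R}_T=\sup_{\nu\in\mathfrak{P}}R_T(\nu)$ and $\mathcal{S}_T=\sup_{\nu\in\mathfrak{P}}S_T(\nu)$. Consider any algorithm such that, for all $\nu\in\mathfrak{P}$ and all $T$, (i) $\mathbb{E}[N_{i,T}]=\mathbb{E}[N_{j,T}]$ whenever $\nu_i=\nu_j$, and (ii) $\mathbb{E}[N_{i,T}]\ge 1$ for every arm $i$ if $T\ge K$. If the algorithm is active-learning, i.e. $\lim_{T\to\infty}\mathcal{R}_T/T=0$, then $\mathcal{S}_T=\omega(\sqrt T)$, i.e. $\mathcal{S}_T/\sqrt T\to\infty$ as $T\to\infty$. -/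

import Mathlib

open MeasureTheory ProbabilityTheory Filter Topology

noncomputable section

namespace Bandit

/-- A stochastic bandit instance `ν = (ν₁, …, ν_K)`: a number of arms `K` and, for every arm, a
reward distribution, which is a probability measure on `ℝ`. -/
structure Instance where
  /-- the number of arms -/
  K : ℕ
  /-- the reward distributions -/
  arm : Fin K → ProbabilityMeasure ℝ

/-- The mean reward `μ_i` of arm `i`. -/
def Instance.mean (ν : Instance) (i : Fin ν.K) : ℝ :=
  ∫ y, y ∂(ν.arm i : Measure ℝ)

/-- The mean-reward gap `Δ_i = max_j μ_j - μ_i`. -/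
def Instance.gap (ν : Instance) (i : Fin ν.K) : ℝ :=
  (⨆ j, ν.mean j) - ν.mean i

/-- The instances with `2 ≤ K ≤ Kbar` arms all of whose reward distributions have a mean in
`[-M, M]` and are `σ`-sub-Gaussian, that is,
`E exp (u (X - μ_i)) ≤ exp (σ² u² / 2)` for all real `u`. -/
def subGaussianClass (M σ : ℝ) (Kbar : ℕ) : Set Instance :=
  {ν | 2 ≤ ν.K ∧ ν.K ≤ Kbar ∧ ∀ i,
    ν.mean i ∈ Set.Icc (-M) M ∧
    HasSubgaussianMGF (fun y : ℝ => y - ν.mean i) (Real.toNNReal (σ ^ 2))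
      (ν.arm i : Measure ℝ)}

/-- A history `(A₁, r₁, …, A_t, r_t)` of `t` rounds (numbered from `0`): the arms pulled and the
rewards collected. -/
abbrev History (K t : ℕ) : Type := Fin t → Fin K × ℝ

/-- The number of pulls `N_{i,t}` of arm `i` in a history of `t` rounds. -/
def pullCount {K t : ℕ} (i : Fin K) (h : History K t) : ℕ :=
  (Finset.univ.filter fun s => (h s).1 = i).card

/-- A bandit algorithm. For every number of arms `K ≥ 2` and every horizon `T` it has a sequence of
decision rules; `rule K T t h` is the distribution of the arm pulled next, when `h` is the history
of the first `t` rounds. (Only the rules with `t < T` matter. An algorithm that does not know its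
horizon is one whose rules do not depend on `T`.) -/
structure Algorithm where
  /-- the decision rules -/
  rule : (K T t : ℕ) → Kernel (History K t) (Fin K)
  /-- each decision rule yields probability distributions over the arms -/
  isMarkov : ∀ K T t, 2 ≤ K → IsMarkovKernel (rule K T t)

/-- A reward table: `x (i, s)` is the reward of the pull number `s + 1` of arm `i`. -/
abbrev RewardTable (K : ℕ) : Type := Fin K × ℕ → ℝ

/-- The law of the reward table: the rewards of arm `i` are i.i.d. with law `ν_i`, and the reward
sequences of different arms are independent. -/
def Instance.tableLaw (ν : Instance) : Measure (RewardTable ν.K) :=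
  Measure.infinitePi fun p : Fin ν.K × ℕ => (ν.arm p.1 : Measure ℝ)

/-- One more round: arm `a` is pulled after the history `h`, and the collected reward is the next
unused reward of that arm in the table `x`. -/
def nextHistory {K t : ℕ} (p : RewardTable K × (History K t × Fin K)) : History K (t + 1) :=
  Fin.snoc (α := fun _ => Fin K × ℝ) p.2.1 (p.2.2, p.1 (p.2.2, pullCount p.2.2 p.2.1))

lemma measurable_pullCount {K t : ℕ} (i : Fin K) : Measurable (pullCount (t := t) i) := by
  unfold pullCount
  simp_rw [Finset.card_filter]
  refine Finset.measurable_sum _ fun s _ => ?_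
  exact Measurable.ite (((measurable_fst.comp (measurable_pi_apply s))) (measurableSet_singleton i)) measurable_const measurable_const

lemma measurable_nextHistory {K t : ℕ} : Measurable (nextHistory (K := K) (t := t)) := by
  refine measurable_pi_iff.2 fun s => ?_
  refine Fin.lastCases ?_ (fun s => ?_) s
  · simp only [nextHistory, Fin.snoc_last]
    refine Measurable.prodMk (by fun_prop) ?_
    have h1 : Measurable fun q : (Fin K × ℕ) × RewardTable K => q.2 q.1 :=
      measurable_from_prod_countable_right fun p => measurable_pi_apply p
    have h2 : Measurable fun q : Fin K × History K t => pullCount q.1 q.2 :=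
      measurable_from_prod_countable_right fun p => measurable_pullCount p
    have h3 : Measurable fun p : RewardTable K × (History K t × Fin K) => pullCount p.2.2 p.2.1 :=
      h2.comp (g := fun q : Fin K × History K t => pullCount q.1 q.2)
        (f := fun p : RewardTable K × (History K t × Fin K) => (p.2.2, p.2.1)) (by fun_prop)
    exact h1.comp (f := fun p : RewardTable K × (History K t × Fin K) =>
      ((p.2.2, pullCount p.2.2 p.2.1), p.1)) (by fun_prop)
  · simp only [nextHistory, Fin.snoc_castSucc]
    fun_prop

/-- The conditional law of the history of the first `t` rounds, given the reward table: the arm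
pulled after the history `h` of `t` rounds is drawn from `rule t h`. -/
def historyKernel {K : ℕ} (rule : (t : ℕ) → Kernel (History K t) (Fin K)) :
    (t : ℕ) → Kernel (RewardTable K) (History K t)
  | 0 => Kernel.const _ (Measure.dirac Fin.elim0)
  | t + 1 => (Kernel.id ×ₖ (historyKernel rule t ⊗ₖ Kernel.prodMkLeft _ (rule t))).map nextHistory

instance isMarkovKernel_historyKernel {K : ℕ} (rule : (t : ℕ) → Kernel (History K t) (Fin K))
    [∀ t, IsMarkovKernel (rule t)] : ∀ t, IsMarkovKernel (historyKernel rule t)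
  | 0 => by unfold historyKernel; infer_instance
  | t + 1 => by
    have := isMarkovKernel_historyKernel rule t
    unfold historyKernel
    exact Kernel.IsMarkovKernel.map _ measurable_nextHistory

instance isProbabilityMeasure_tableLaw (ν : Instance) : IsProbabilityMeasure ν.tableLaw := by
  unfold Instance.tableLaw; infer_instance

namespace Algorithm

/-- The law of the history of all `T` rounds when the algorithm is run with horizon `T` on the
instance `ν`. -/
def law (π : Algorithm) (T : ℕ) (ν : Instance) : Measure (History ν.K T) :=
  historyKernel (π.rule ν.K T) T ∘ₘ ν.tableLaw

lemma isProbabilityMeasure_law (π : Algorithm) (T : ℕ) (ν : Instance) (h : 2 ≤ ν.K) :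
    IsProbabilityMeasure (π.law T ν) := by
  have := fun t => π.isMarkov ν.K T t h
  unfold Algorithm.law; infer_instance

/-- The expected number of pulls `E[N_{i,T}]`. -/
def expPulls (π : Algorithm) (T : ℕ) (ν : Instance) (i : Fin ν.K) : ℝ :=
  ∫ h, (pullCount i h : ℝ) ∂(π.law T ν)

/-- The (expected pseudo-)regret `R_T(ν) = ∑ i, Δ_i E[N_{i,T}]`. -/
def regret (π : Algorithm) (T : ℕ) (ν : Instance) : ℝ :=
  ∑ i, ν.gap i * π.expPulls T ν i

/-- The allocation variability `S_T(ν) = max_i √Var(N_{i,T})`. -/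
def allocVar (π : Algorithm) (T : ℕ) (ν : Instance) : ℝ :=
  ⨆ i : Fin ν.K, √(variance (fun h => (pullCount i h : ℝ)) (π.law T ν))

/-- The worst-case regret `𝓡_T` over the class `P` of instances. (It is at most `2 M T` over the
instances whose means lie in `[-M, M]`.) -/
def worstRegret (π : Algorithm) (P : Set Instance) (T : ℕ) : ℝ :=
  sSup (π.regret T '' P)

/-- The worst-case allocation variability `𝓢_T` over the class `P` of instances. (It is at most
`T`.) -/
def worstAllocVar (π : Algorithm) (P : Set Instance) (T : ℕ) : ℝ :=
  sSup (π.allocVar T '' P)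

/-- The regularity conditions on algorithms: arms with the same reward distribution are pulled
equally often in expectation, and every arm is pulled at least once in expectation as soon as
`T ≥ K`. -/
structure IsRegular (π : Algorithm) (P : Set Instance) : Prop where
  /-- identical arms are treated equally in expectation -/
  symm : ∀ ν ∈ P, ∀ T : ℕ, ∀ i j : Fin ν.K, ν.arm i = ν.arm j →
    π.expPulls T ν i = π.expPulls T ν j
  /-- each arm is pulled at least once in expectation -/
  one_le : ∀ ν ∈ P, ∀ T : ℕ, ν.K ≤ T → ∀ i : Fin ν.K, 1 ≤ π.expPulls T ν i

/-- Active learning: the worst-case regret is sublinear in the horizon. -/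
def IsActiveLearning (π : Algorithm) (P : Set Instance) : Prop :=
  Tendsto (fun T : ℕ => π.worstRegret P T / (T : ℝ)) atTop (𝓝 0)

end Algorithm

end Bandit

end

/-! Two-armed instances with rewards in `{-a, a}` suffice, where `a = min M σ`. Arm `0` yields `a`
with probability `p` and arm `1` is a fair coin. Let `f p` be the expected number of pulls of arm
`0`, and `S` the worst-case allocation variability.

The derivative of `f` is the covariance of the pull count with the score, the logarithmic derivative
of the likelihood. The decision rules do not depend on `p`, so only pulls of arm `0` contribute to
the score, and its second moment is `f p / (p (1 - p))`. Cauchy–Schwarz gives `f' ^ 2 ≤ S ^ 2 * f /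
(p (1 - p))` (`sq_deriv_coinExp_le`). Dividing by `2 √f` cancels `f`: on `[1/4, 1/2]` the function
`√f` is Lipschitz with constant `2 S` (`sqrt_coinExp_sub_le`). Regularity condition (ii) enters only
to keep `f` positive, so that `√f` is differentiable.

At `p = 1/2` the arms are identical and symmetry forces `f = T / 2`. At `p = 1/2 - δ` arm `0` has
gap `2 δ a`, so sublinear regret forces `f ≤ T / 8` for large `T`. Hence `√f` climbs by at least
`√(T / 8)` over an interval of length `δ`, and `S ≥ √(T / 8) / (2 δ)`
(`Algorithm.IsRegular.sqrt_le_worstAllocVar`). As `δ` is arbitrary, `S / √T` tends to infinity. -/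

noncomputable section

namespace Bandit

open scoped ENNReal

/-! ### The probability of a single history -/

/-- The entry of the reward table that a history uses in round `s`. -/
def tableIndex {K t : ℕ} (h : History K t) (s : Fin t) : Fin K × ℕ :=
  ((h s).1, (Finset.univ.filter fun r => r < s ∧ (h r).1 = (h s).1).card)

/-- Two rounds with the same arm differ in the second coordinate: the earlier pulls counted at `s`
include `r` and everything counted at `r`. -/
lemma tableIndex_ne_of_lt {K t : ℕ} (h : History K t) {r s : Fin t} (hrs : r < s) :
    tableIndex h r ≠ tableIndex h s := by
  intro he
  simp only [tableIndex, Prod.mk.injEq] at he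
  refine he.2.not_lt (Finset.card_lt_card ?_)
  rw [Finset.ssubset_iff_of_subset]
  · exact ⟨r, by simp [hrs, he.1], by simp⟩
  · intro u hu
    simp only [Finset.mem_filter, Finset.mem_univ, true_and] at hu ⊢
    exact ⟨hu.1.trans hrs, hu.2.trans he.1⟩

lemma tableIndex_injective {K t : ℕ} (h : History K t) : Function.Injective (tableIndex h) := by
  intro r s he
  rcases lt_trichotomy r s with hlt | heq | hlt
  · exact absurd he (tableIndex_ne_of_lt h hlt)
  · exact heq
  · exact absurd he.symm (tableIndex_ne_of_lt h hlt)

lemma tableIndex_last {K t : ℕ} (h : History K (t + 1)) :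
    tableIndex h (Fin.last t) =
      ((h (Fin.last t)).1, pullCount (t := t) (h (Fin.last t)).1 (Fin.init h)) := by
  simp [-Finset.sum_boole, tableIndex, pullCount, Finset.card_filter, Fin.sum_univ_castSucc, Fin.init,
    Fin.castSucc_lt_last]
  exact (Finset.card_filter _ _).symm

lemma tableIndex_castSucc {K t : ℕ} (h : History K (t + 1)) (s : Fin t) :
    tableIndex h s.castSucc = tableIndex (t := t) (Fin.init h) s := by
  simp [-Finset.sum_boole, tableIndex, Finset.card_filter, Fin.sum_univ_castSucc, Fin.init,
    (Fin.castSucc_lt_last s).not_gt]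
  exact (Finset.card_filter _ _).symm

/-- The reward tables under which the rewards recorded in a history are collected. -/
def consistentTables {K t : ℕ} (h : History K t) : Set (RewardTable K) :=
  {x | ∀ s, x (tableIndex h s) = (h s).2}

lemma mem_consistentTables_succ {K t : ℕ} (h : History K (t + 1)) (x : RewardTable K) :
    x ∈ consistentTables h ↔ x ∈ consistentTables (t := t) (Fin.init h) ∧
      x ((h (Fin.last t)).1, pullCount (t := t) (h (Fin.last t)).1 (Fin.init h)) =
        (h (Fin.last t)).2 := by
  simp only [consistentTables, Set.mem_ofPred_eq, Fin.forall_fin_succ', tableIndex_last,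
    tableIndex_castSucc]
  rfl

/-- A history never reads the same table entry twice, so its rewards are constraints on distinct,
hence independent, coordinates. -/
lemma tableLaw_consistentTables (ν : Instance) {t : ℕ} (h : History ν.K t) :
    ν.tableLaw (consistentTables h) = ∏ s, (ν.arm (h s).1 : Measure ℝ) {(h s).2} := by
  -- The constraint at an entry is phrased over all rounds that use it, so no inverse of
  -- `tableIndex` is needed; injectivity collapses it to a singleton.
  have heq : consistentTables h = Set.pi
      ((Finset.univ.map ⟨tableIndex h, tableIndex_injective h⟩ : Finset (Fin ν.K × ℕ)) : Set _)
      (fun p => {y | ∀ s, tableIndex h s = p → y = (h s).2}) := by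
    ext x
    simp only [consistentTables, Set.mem_ofPred_eq, Finset.coe_map, Function.Embedding.coeFn_mk,
      Finset.coe_univ, Set.image_univ, Set.mem_pi, Set.forall_mem_range]
    constructor
    · intro hx s r hr
      rw [← hr, hx]
    · intro hx s
      exact hx s s rfl
  have hsing : ∀ s, {y : ℝ | ∀ r, tableIndex h r = tableIndex h s → y = (h r).2} = {(h s).2} := by
    intro s
    ext y
    simp [(tableIndex_injective h).eq_iff]
  rw [heq, Instance.tableLaw, Measure.infinitePi_pi]
  · rw [Finset.prod_map]
    simp only [Function.Embedding.coeFn_mk, hsing]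
    rfl
  · intro p hp
    obtain ⟨s, -, rfl⟩ := Finset.mem_map.1 hp
    simp [hsing]

/-- The probability that all the arms of a history are pulled, given its rewards. -/
def pathWeight {K : ℕ} (rule : (t : ℕ) → Kernel (History K t) (Fin K)) :
    (t : ℕ) → History K t → ℝ≥0∞
  | 0, _ => 1
  | t + 1, h => pathWeight rule t (Fin.init h) * rule t (Fin.init h) {(h (Fin.last t)).1}

lemma nextHistory_eq_iff {K t : ℕ} (x : RewardTable K) (h' : History K t) (a : Fin K)
    (h : History K (t + 1)) : nextHistory (x, h', a) = h ↔
      h' = Fin.init h ∧ a = (h (Fin.last t)).1 ∧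
      x ((h (Fin.last t)).1, pullCount (t := t) (h (Fin.last t)).1 (Fin.init h)) =
        (h (Fin.last t)).2 := by
  constructor
  · rintro rfl
    simp [nextHistory]
  · rintro ⟨rfl, rfl, hx⟩
    simp only [nextHistory]
    rw [hx]
    exact Fin.snoc_init_self (α := fun _ => Fin K × ℝ) h

open Classical in
-- Once the table is fixed, the arm draws are the only randomness; the rewards either match the
-- table or they do not.
lemma historyKernel_singleton {K : ℕ} (rule : (t : ℕ) → Kernel (History K t) (Fin K))
    [∀ t, IsMarkovKernel (rule t)] (x : RewardTable K) (t : ℕ) (h : History K t) :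
    historyKernel rule t x {h} =
      if x ∈ consistentTables h then pathWeight rule t h else 0 := by
  induction t with
  | zero =>
    have : h = Fin.elim0 := Subsingleton.elim _ _
    simp [historyKernel, consistentTables, pathWeight, this]
  | succ t ih =>
    have hpre : Prod.mk x ⁻¹' (nextHistory (K := K) (t := t) ⁻¹' {h}) =
        if x ((h (Fin.last t)).1, pullCount (t := t) (h (Fin.last t)).1 (Fin.init h)) =
          (h (Fin.last t)).2 then {Fin.init h} ×ˢ {(h (Fin.last t)).1} else ∅ := by
      ext ⟨h', a⟩
      simp only [Set.mem_preimage, Set.mem_singleton_iff, nextHistory_eq_iff]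
      split_ifs with hx <;> simp [hx]
    rw [historyKernel, Kernel.map_apply' _ measurable_nextHistory _ (measurableSet_singleton h),
      Kernel.id_prod_apply' _ _ (measurable_nextHistory (measurableSet_singleton h)), hpre,
      pathWeight]
    simp only [mem_consistentTables_succ]
    by_cases hx : x ((h (Fin.last t)).1, pullCount (t := t) (h (Fin.last t)).1 (Fin.init h)) =
          (h (Fin.last t)).2
    · rw [if_pos hx, Kernel.compProd_apply_prod (measurableSet_singleton _)
        (measurableSet_singleton _), lintegral_singleton, Kernel.prodMkLeft_apply, ih]
      simp [hx, mul_comm]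
    · simp [hx]

lemma measurableSet_consistentTables {K t : ℕ} (h : History K t) :
    MeasurableSet (consistentTables h) := by
  simp only [consistentTables, Set.ofPred_forall]
  exact MeasurableSet.iInter fun s =>
    (measurable_pi_apply (tableIndex h s)) (measurableSet_singleton _)

/-- The likelihood splits into a factor of the algorithm and a factor of the reward laws. Only the
latter varies with `p` later on. -/
lemma Algorithm.law_singleton (π : Algorithm) (T : ℕ) (ν : Instance) (hK : 2 ≤ ν.K)
    (h : History ν.K T) :
    π.law T ν {h} =
      pathWeight (π.rule ν.K T) T h * ∏ s, (ν.arm (h s).1 : Measure ℝ) {(h s).2} := by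
  classical
  have := fun t => π.isMarkov ν.K T t hK
  rw [Algorithm.law, Measure.bind_apply (measurableSet_singleton h) (Kernel.aemeasurable _)]
  simp_rw [historyKernel_singleton]
  rw [← tableLaw_consistentTables, ← lintegral_indicator_const (measurableSet_consistentTables h)]
  simp only [Set.indicator]

/-! ### The score and the Lipschitz bound for coin rewards -/

/-- An outcome of one round of a two-armed bandit with two-valued rewards: the arm pulled, and
whether the reward is the larger one. -/
abbrev CoinOutcome : Type := Fin 2 × Bool

/-- The probability of the reward of an outcome given its arm: arm `0` yields the larger reward
with probability `p`, arm `1` with probability `1 / 2`. -/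
def coinProb (p : ℝ) (y : CoinOutcome) : ℝ :=
  if y.1 = 0 then (if y.2 then p else 1 - p) else 1 / 2

/-- The logarithmic derivative of `coinProb p y` with respect to `p`. -/
def coinScore (p : ℝ) (y : CoinOutcome) : ℝ :=
  if y.1 = 0 then (if y.2 then 1 / p else -(1 / (1 - p))) else 0

/-- The probability of a path of outcomes, if arm `a` is pulled with probability `u t h a` after
the path `h` of `t` rounds. -/
def coinWeight (u : (t : ℕ) → (Fin t → CoinOutcome) → Fin 2 → ℝ) (p : ℝ) :
    (t : ℕ) → (Fin t → CoinOutcome) → ℝ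
  | 0, _ => 1
  | t + 1, h => coinWeight u p t (Fin.init h) *
      (u t (Fin.init h) (h (Fin.last t)).1 * coinProb p (h (Fin.last t)))

/-- The score of a path, which is the sum of the scores of its rounds. -/
def pathScore (p : ℝ) {t : ℕ} (h : Fin t → CoinOutcome) : ℝ := ∑ s, coinScore p (h s)

/-- The number of pulls of arm `0` in a path. -/
def pathPulls {t : ℕ} (h : Fin t → CoinOutcome) : ℝ := ∑ s, if (h s).1 = 0 then 1 else 0

/-- The expectation of a function of the path. -/
def coinExp (u : (t : ℕ) → (Fin t → CoinOutcome) → Fin 2 → ℝ) (p : ℝ) (t : ℕ)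
    (F : (Fin t → CoinOutcome) → ℝ) : ℝ :=
  ∑ h, coinWeight u p t h * F h

lemma coinProb_nonneg {p : ℝ} (hp : p ∈ Set.Icc (0 : ℝ) 1) (y : CoinOutcome) :
    0 ≤ coinProb p y := by
  unfold coinProb
  split_ifs
  · exact hp.1
  · linarith [hp.2]
  · norm_num

lemma hasDerivAt_coinProb {p : ℝ} (h0 : p ≠ 0) (h1 : 1 - p ≠ 0) (y : CoinOutcome) :
    HasDerivAt (fun p => coinProb p y) (coinProb p y * coinScore p y) p := by
  unfold coinProb coinScore
  split_ifs
  · simpa [h0] using hasDerivAt_id' p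
  · simpa [h1] using (hasDerivAt_id' p).const_sub 1
  · simpa using hasDerivAt_const p (2⁻¹ : ℝ)

variable {u : (t : ℕ) → (Fin t → CoinOutcome) → Fin 2 → ℝ}

lemma coinWeight_nonneg (hu : ∀ t h a, 0 ≤ u t h a) {p : ℝ} (hp : p ∈ Set.Icc (0 : ℝ) 1)
    (t : ℕ) (h : Fin t → CoinOutcome) : 0 ≤ coinWeight u p t h := by
  induction t with
  | zero => simp [coinWeight]
  | succ t ih => exact mul_nonneg (ih _) (mul_nonneg (hu _ _ _) (coinProb_nonneg hp _))

lemma hasDerivAt_coinWeight {p : ℝ} (h0 : p ≠ 0) (h1 : 1 - p ≠ 0) (t : ℕ)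
    (h : Fin t → CoinOutcome) :
    HasDerivAt (fun p => coinWeight u p t h) (coinWeight u p t h * pathScore p h) p := by
  induction t with
  | zero => simpa [coinWeight, pathScore] using hasDerivAt_const p (1 : ℝ)
  | succ t ih =>
    simp only [coinWeight]
    refine ((ih (Fin.init h)).mul
      ((hasDerivAt_coinProb h0 h1 (h (Fin.last t))).const_mul _)).congr_deriv ?_
    simp only [pathScore, Fin.sum_univ_castSucc, Fin.init]
    ring

lemma hasDerivAt_coinExp {p : ℝ} (h0 : p ≠ 0) (h1 : 1 - p ≠ 0) (t : ℕ)
    (F : (Fin t → CoinOutcome) → ℝ) :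
    HasDerivAt (fun p => coinExp u p t F) (coinExp u p t fun h => F h * pathScore p h) p := by
  unfold coinExp
  refine (HasDerivAt.fun_sum fun h _ =>
    (hasDerivAt_coinWeight h0 h1 t h).mul_const (F h)).congr_deriv ?_
  exact Finset.sum_congr rfl fun h _ => by ring

lemma coinExp_add (p : ℝ) (t : ℕ) (F G : (Fin t → CoinOutcome) → ℝ) :
    coinExp u p t (fun h => F h + G h) = coinExp u p t F + coinExp u p t G := by
  simp only [coinExp, mul_add, Finset.sum_add_distrib]

lemma coinExp_mul_const (p : ℝ) (t : ℕ) (F : (Fin t → CoinOutcome) → ℝ) (c : ℝ) :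
    coinExp u p t (fun h => F h * c) = coinExp u p t F * c := by
  simp only [coinExp, Finset.sum_mul, mul_assoc]

lemma coinExp_succ (p : ℝ) (t : ℕ) (F : (Fin (t + 1) → CoinOutcome) → ℝ) :
    coinExp u p (t + 1) F = coinExp u p t fun h =>
      ∑ y : CoinOutcome, u t h y.1 * coinProb p y *
        F (Fin.snoc (α := fun _ => CoinOutcome) h y) := by
  unfold coinExp
  rw [← (Fin.snocEquiv fun _ => CoinOutcome).sum_comp, Fintype.sum_prod_type_right]
  refine Finset.sum_congr rfl fun h _ => ?_
  rw [Finset.mul_sum]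
  refine Finset.sum_congr rfl fun y _ => ?_
  simp [Fin.snocEquiv, coinWeight, mul_assoc]

lemma pathScore_snoc (p : ℝ) {t : ℕ} (h : Fin t → CoinOutcome) (y : CoinOutcome) :
    pathScore p (Fin.snoc (α := fun _ => CoinOutcome) h y : Fin (t + 1) → CoinOutcome) =
      pathScore p h + coinScore p y := by
  simp [pathScore, Fin.sum_univ_castSucc]

lemma pathPulls_snoc {t : ℕ} (h : Fin t → CoinOutcome) (y : CoinOutcome) :
    pathPulls (Fin.snoc (α := fun _ => CoinOutcome) h y : Fin (t + 1) → CoinOutcome) =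
      pathPulls h + if y.1 = 0 then 1 else 0 := by
  unfold pathPulls
  rw [Fin.sum_univ_castSucc]
  simp

lemma coinExp_one (hu : ∀ t h, ∑ a, u t h a = 1) (p : ℝ) (t : ℕ) :
    coinExp u p t (fun _ => 1) = 1 := by
  induction t with
  | zero => simp [coinExp, coinWeight]
  | succ t ih =>
    rw [coinExp_succ]
    refine Eq.trans (congrArg _ (funext fun h => ?_)) ih
    have := hu t h
    simp only [Fin.sum_univ_two] at this
    simp [Fintype.sum_prod_type, coinProb]
    linarith

/-- The total mass is constantly `1`, and its derivative in `p` is the expected score. -/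
lemma coinExp_pathScore (hu : ∀ t h, ∑ a, u t h a = 1) {p : ℝ} (h0 : p ≠ 0) (h1 : 1 - p ≠ 0)
    (t : ℕ) : coinExp u p t (pathScore p) = 0 := by
  have h := hasDerivAt_coinExp (u := u) h0 h1 t (fun _ => 1)
  simp only [coinExp_one hu, one_mul] at h
  exact h.unique (hasDerivAt_const p 1)

/-- The score is a martingale: given the past, an increment has mean zero, which kills the cross
term. Its conditional second moment is the probability of pulling arm `0` times `1 / p + 1 / (1 - p)
= 1 / (p (1 - p))`. -/
lemma coinExp_pathScore_sq (hu : ∀ t h, ∑ a, u t h a = 1) {p : ℝ} (h0 : p ≠ 0)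
    (h1 : 1 - p ≠ 0) (t : ℕ) :
    coinExp u p t (fun h => pathScore p h ^ 2) =
      coinExp u p t pathPulls * (1 / (p * (1 - p))) := by
  rw [← coinExp_mul_const]
  induction t with
  | zero => simp [coinExp, coinWeight, pathScore, pathPulls]
  | succ t ih =>
    rw [coinExp_succ, coinExp_succ]
    have hstep : ∀ h : Fin t → CoinOutcome,
        (∑ y : CoinOutcome, u t h y.1 * coinProb p y *
          pathScore p (Fin.snoc (α := fun _ => CoinOutcome) h y : Fin (t + 1) → _) ^ 2) =
        pathScore p h ^ 2 + u t h 0 * (1 / (p * (1 - p))) := by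
      intro h
      have := hu t h
      rw [Fin.sum_univ_two] at this
      obtain h2 : u t h 1 = 1 - u t h 0 := by linarith
      simp only [pathScore_snoc, Fintype.sum_prod_type, Fin.sum_univ_two, Fintype.sum_bool,
        coinProb, coinScore, h2]
      simp
      field_simp
      ring
    have hstep' : ∀ h : Fin t → CoinOutcome,
        (∑ y : CoinOutcome, u t h y.1 * coinProb p y *
          (pathPulls (Fin.snoc (α := fun _ => CoinOutcome) h y : Fin (t + 1) → _) *
            (1 / (p * (1 - p))))) =
        pathPulls h * (1 / (p * (1 - p))) + u t h 0 * (1 / (p * (1 - p))) := by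
      intro h
      have := hu t h
      rw [Fin.sum_univ_two] at this
      obtain h2 : u t h 1 = 1 - u t h 0 := by linarith
      simp only [pathPulls_snoc, Fintype.sum_prod_type, Fin.sum_univ_two, Fintype.sum_bool,
        coinProb, h2]
      simp
      ring
    simp only [hstep, hstep', coinExp_add, ih]

/-- The derivative of the expected number of pulls is at most its standard deviation times the
standard deviation of the score. -/
lemma sq_deriv_coinExp_le (hu0 : ∀ t h a, 0 ≤ u t h a) (hu : ∀ t h, ∑ a, u t h a = 1) {p : ℝ}
    (hp : p ∈ Set.Ioo (0 : ℝ) 1) (t : ℕ) :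
    (coinExp u p t fun h => pathPulls h * pathScore p h) ^ 2 ≤
      coinExp u p t (fun h => (pathPulls h - coinExp u p t pathPulls) ^ 2) *
        (coinExp u p t pathPulls * (1 / (p * (1 - p)))) := by
  have h0 : p ≠ 0 := hp.1.ne'
  have h1 : 1 - p ≠ 0 := (sub_pos.2 hp.2).ne'
  have hW := coinWeight_nonneg hu0 ⟨hp.1.le, hp.2.le⟩ t
  set m := coinExp u p t pathPulls with hm
  -- The score has mean zero, so centring the pull count does not change the product moment.
  have hcenter : (coinExp u p t fun h => pathPulls h * pathScore p h) =
      coinExp u p t fun h => (pathPulls h - m) * pathScore p h := by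
    have hsplit : (fun h : Fin t → CoinOutcome => pathPulls h * pathScore p h) =
        fun h => (pathPulls h - m) * pathScore p h + pathScore p h * m := by
      ext h
      ring
    rw [hsplit, coinExp_add, coinExp_mul_const, coinExp_pathScore hu h0 h1]
    ring
  rw [hcenter, hm, ← coinExp_pathScore_sq hu h0 h1, ← hm]
  -- Cauchy–Schwarz with the path probabilities as weights.
  refine Finset.sum_sq_le_sum_mul_sum_of_sq_le_mul _ (fun h _ => mul_nonneg (hW h) (sq_nonneg _))
    (fun h _ => mul_nonneg (hW h) (sq_nonneg _)) fun h _ => le_of_eq (by ring)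

/-- If the standard deviation of the number of pulls is at most `S`, then the square root of its
expectation is Lipschitz as a function of `p`. -/
lemma sqrt_coinExp_sub_le (hu0 : ∀ t h a, 0 ≤ u t h a) (hu : ∀ t h, ∑ a, u t h a = 1) {δ S : ℝ}
    (hδ : 0 ≤ δ) (hδ' : δ ≤ 1 / 4) (hS : 0 ≤ S) (t : ℕ)
    (hpos : ∀ p ∈ Set.Icc (1 / 2 - δ) (1 / 2), 0 < coinExp u p t pathPulls)
    (hvar : ∀ p ∈ Set.Icc (1 / 2 - δ) (1 / 2),
      coinExp u p t (fun h => (pathPulls h - coinExp u p t pathPulls) ^ 2) ≤ S ^ 2) :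
    √(coinExp u (1 / 2) t pathPulls) - √(coinExp u (1 / 2 - δ) t pathPulls) ≤ 2 * S * δ := by
  have hderiv : ∀ p ∈ Set.Icc (1 / 2 - δ) (1 / 2),
      HasDerivWithinAt (fun p => √(coinExp u p t pathPulls))
        ((coinExp u p t fun h => pathPulls h * pathScore p h) /
          (2 * √(coinExp u p t pathPulls))) (Set.Icc (1 / 2 - δ) (1 / 2)) p := by
    intro p hp
    have h0 : p ≠ 0 := by linarith [hp.1]
    have h1 : 1 - p ≠ 0 := by linarith [hp.2]
    exact ((hasDerivAt_coinExp h0 h1 t pathPulls).sqrt (hpos p hp).ne').hasDerivWithinAt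
  have hbound : ∀ p ∈ Set.Icc (1 / 2 - δ) (1 / 2),
      ‖(coinExp u p t fun h => pathPulls h * pathScore p h) /
          (2 * √(coinExp u p t pathPulls))‖ ≤ 2 * S := by
    intro p hp
    have h0 : 1 / 4 ≤ p := by linarith [hp.1]
    have h1 : p ≤ 1 / 2 := hp.2
    have hf := hpos p hp
    have hsq := Real.sq_sqrt hf.le
    have hsp := Real.sqrt_pos.2 hf
    -- Any constant would do; a perfect square makes the bound below the square of `4 S √f`.
    have hmul : 1 / (p * (1 - p)) ≤ 16 := by
      rw [div_le_iff₀ (by nlinarith)]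
      nlinarith
    have hle := sq_deriv_coinExp_le hu0 hu (p := p) ⟨by linarith, by linarith⟩ t
    have hle' : (coinExp u p t fun h => pathPulls h * pathScore p h) ^ 2 ≤
        (2 * S * (2 * √(coinExp u p t pathPulls))) ^ 2 := by
      refine hle.trans ((mul_le_mul (hvar p hp) (mul_le_mul_of_nonneg_left hmul hf.le)
        (mul_nonneg hf.le (one_div_nonneg.2 (by nlinarith))) (sq_nonneg S)).trans_eq ?_)
      rw [mul_pow, mul_pow, mul_pow 2, hsq]
      ring
    rw [Real.norm_eq_abs, abs_div, abs_of_pos (by positivity : 0 < 2 * √(coinExp u p t pathPulls)),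
      div_le_iff₀ (by positivity)]
    exact abs_le_of_sq_le_sq hle' (by positivity)
  have := (convex_Icc (1 / 2 - δ) (1 / 2)).norm_image_sub_le_of_norm_hasDerivWithin_le hderiv hbound
    (x := 1 / 2 - δ) (y := 1 / 2) ⟨le_rfl, by linarith⟩ ⟨by linarith, le_rfl⟩
  rw [sub_sub_cancel, Real.norm_eq_abs, Real.norm_eq_abs, abs_of_nonneg hδ] at this
  exact (le_abs_self _).trans this

/-! ### Coin bandits as bandit instances -/

/-- The law of a reward that is `a` with probability `p` and `-a` otherwise. -/
def coinArm (a : ℝ) (p : unitInterval) : ProbabilityMeasure ℝ :=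
  ⟨bernoulliMeasure a (-a) p, inferInstance⟩

/-- The midpoint of the unit interval. -/
def unitHalf : unitInterval := ⟨1 / 2, by norm_num, by norm_num⟩

/-- The bandit with two arms and rewards in `{-a, a}`, whose arm `0` yields `a` with probability
`p` and whose arm `1` is a fair coin. -/
abbrev twoArm (a : ℝ) (p : unitInterval) : Instance where
  K := 2
  arm := ![coinArm a p, coinArm a unitHalf]

/-- The history that belongs to a path of outcomes. -/
def toHistory (a : ℝ) {t : ℕ} (h : Fin t → CoinOutcome) : History 2 t :=
  fun s => ((h s).1, if (h s).2 then a else -a)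

lemma toHistory_injective {a : ℝ} (ha : 0 < a) (t : ℕ) :
    Function.Injective (toHistory a (t := t)) := by
  intro h h' heq
  ext s
  · have hs : (h s).1 = (h' s).1 :=
      congrArg (fun g : History 2 t => (g s).1) heq
    exact congrArg Fin.val hs
  · have hs : (if (h s).2 then a else -a) = if (h' s).2 then a else -a :=
      congrArg (fun g : History 2 t => (g s).2) heq
    have hne : a ≠ -a := by linarith
    have hne' : -a ≠ a := by linarith
    cases h1 : (h s).2 <;> cases h2 : (h' s).2 <;> simp [h1, h2, hne, hne'] at hs ⊢

lemma coinArm_real_singleton {a : ℝ} (ha : 0 < a) (p : unitInterval) (b : Bool) :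
    (coinArm a p : Measure ℝ).real {if b then a else -a} = if b then (p : ℝ) else 1 - p := by
  have hne : a ≠ -a := by linarith
  have hne' : -a ≠ a := by linarith
  change (bernoulliMeasure a (-a) p).real _ = _
  cases b
  · simp [bernoulliMeasure_real_apply_of_notMem_of_mem, hne]
  · simp [bernoulliMeasure_real_apply_of_mem_of_notMem, hne']

lemma twoArm_real_singleton {a : ℝ} (ha : 0 < a) (p : unitInterval) (y : CoinOutcome) :
    ((twoArm a p).arm y.1 : Measure ℝ).real {if y.2 then a else -a} = coinProb p y := by
  obtain ⟨i, b⟩ := y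
  fin_cases i
  · simpa [coinProb] using coinArm_real_singleton ha p b
  · have := coinArm_real_singleton ha unitHalf b
    simp only [coinProb]
    refine this.trans ?_
    cases b <;> norm_num [unitHalf]

/-- The probability that the rules of an algorithm pull arm `i` after a path of outcomes. -/
def ruleProb (π : Algorithm) (T : ℕ) (a : ℝ) (t : ℕ) (h : Fin t → CoinOutcome) (i : Fin 2) : ℝ :=
  (π.rule 2 T t (toHistory a h)).real {i}

lemma ruleProb_nonneg (π : Algorithm) (T : ℕ) (a : ℝ) (t : ℕ) (h : Fin t → CoinOutcome)
    (i : Fin 2) : 0 ≤ ruleProb π T a t h i := measureReal_nonneg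

lemma sum_ruleProb (π : Algorithm) (T : ℕ) (a : ℝ) (t : ℕ) (h : Fin t → CoinOutcome) :
    ∑ i, ruleProb π T a t h i = 1 := by
  have := π.isMarkov 2 T t le_rfl
  unfold ruleProb
  rw [sum_measureReal_singleton]
  simp

lemma law_twoArm_singleton (π : Algorithm) (T : ℕ) {a : ℝ} (ha : 0 < a) (p : unitInterval)
    (h : Fin T → CoinOutcome) :
    π.law T (twoArm a p) {toHistory a h} =
      ENNReal.ofReal (coinWeight (ruleProb π T a) p T h) := by
  have hweight : ∀ (t : ℕ) (h : Fin t → CoinOutcome),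
      coinWeight (ruleProb π T a) p t h =
        (pathWeight (π.rule 2 T) t (toHistory a h)).toReal * ∏ s, coinProb p (h s) := by
    intro t
    induction t with
    | zero => simp [coinWeight, pathWeight]
    | succ t ih =>
      intro h
      rw [coinWeight, ih, pathWeight, Fin.prod_univ_castSucc, ENNReal.toReal_mul]
      change _ * (_ * _) = (pathWeight (π.rule 2 T) t (toHistory a (Fin.init h))).toReal *
        ruleProb π T a t (Fin.init h) (h (Fin.last t)).1 * _
      simp only [Fin.init]
      ring
  have := π.isProbabilityMeasure_law T (twoArm a p) le_rfl
  rw [← ENNReal.ofReal_toReal (measure_ne_top (π.law T (twoArm a p)) {toHistory a h}),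
    hweight, π.law_singleton T (twoArm a p) le_rfl, ENNReal.toReal_mul, ENNReal.toReal_prod]
  congr 2
  exact Finset.prod_congr rfl fun s _ => twoArm_real_singleton ha p (h s)

/-- The law of a history is purely atomic: the point masses at coin paths already add up to `1`. -/
lemma law_twoArm (π : Algorithm) (T : ℕ) {a : ℝ} (ha : 0 < a) (p : unitInterval) :
    π.law T (twoArm a p) = ∑ h : Fin T → CoinOutcome,
      ENNReal.ofReal (coinWeight (ruleProb π T a) p T h) • Measure.dirac (toHistory a h) := by
  have := π.isProbabilityMeasure_law T (twoArm a p) le_rfl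
  have hW := coinWeight_nonneg (u := ruleProb π T a) (ruleProb_nonneg π T a) p.2 T
  have huniv : (∑ h : Fin T → CoinOutcome, ENNReal.ofReal (coinWeight (ruleProb π T a) p T h) •
      Measure.dirac (toHistory a h)) Set.univ = 1 := by
    have hone := coinExp_one (sum_ruleProb π T a) (p : ℝ) T
    simp only [coinExp, mul_one] at hone
    simp [← ENNReal.ofReal_sum_of_nonneg fun h _ => hW h, hone]
  have : IsProbabilityMeasure (∑ h : Fin T → CoinOutcome,
    ENNReal.ofReal (coinWeight (ruleProb π T a) p T h) • Measure.dirac (toHistory a h)) := ⟨huniv⟩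
  -- Both sides are probability measures, so one inequality is enough. It holds because the atoms
  -- lying in `s` form a finite subset of `s`.
  refine (Measure.eq_of_le_of_isProbabilityMeasure (Measure.le_iff.2 fun s hs => ?_)).symm
  simp only [Measure.coe_finsetSum, Measure.coe_smul, Finset.sum_apply, Pi.smul_apply,
    smul_eq_mul, ← law_twoArm_singleton π T ha p]
  classical
  calc ∑ h, π.law T (twoArm a p) {toHistory a h} * Measure.dirac (toHistory a h) s
      = ∑ h with toHistory a h ∈ s, π.law T (twoArm a p) {toHistory a h} := by
        rw [Finset.sum_filter]
        refine Finset.sum_congr rfl fun h _ => ?_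
        rw [Measure.dirac_apply' _ hs]
        by_cases hm : toHistory a h ∈ s <;> simp [hm]
    _ = π.law T (twoArm a p)
          ((Finset.univ.filter fun h => toHistory a h ∈ s).map
            ⟨toHistory a, toHistory_injective ha T⟩ : Finset (History 2 T)) := by
        rw [← sum_measure_singleton, Finset.sum_map]
        rfl
    _ ≤ _ := measure_mono fun x hx => by
        obtain ⟨h, hh, rfl⟩ := Finset.mem_map.1 (Finset.mem_coe.1 hx)
        exact (Finset.mem_filter.1 hh).2

lemma integral_law_twoArm (π : Algorithm) (T : ℕ) {a : ℝ} (ha : 0 < a) (p : unitInterval)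
    (F : History 2 T → ℝ) :
    ∫ h, F h ∂(π.law T (twoArm a p)) =
      coinExp (ruleProb π T a) p T fun h => F (toHistory a h) := by
  have hW := coinWeight_nonneg (u := ruleProb π T a) (ruleProb_nonneg π T a) p.2 T
  rw [law_twoArm π T ha p, integral_finsetSum_measure]
  · refine Finset.sum_congr rfl fun h _ => ?_
    rw [integral_smul_measure, integral_dirac, ENNReal.toReal_ofReal (hW h), smul_eq_mul]
  · exact fun h _ => (integrable_dirac (by simp)).smul_measure ENNReal.ofReal_ne_top

lemma pullCount_toHistory (a : ℝ) {t : ℕ} (h : Fin t → CoinOutcome) :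
    (pullCount 0 (toHistory a h) : ℝ) = pathPulls h := by
  rw [pullCount, pathPulls, Finset.card_filter]
  push_cast
  rfl

lemma measurable_pullCount_real {K t : ℕ} (i : Fin K) :
    Measurable fun h : History K t => (pullCount i h : ℝ) :=
  measurable_from_nat.comp (measurable_pullCount i)

lemma expPulls_twoArm (π : Algorithm) (T : ℕ) {a : ℝ} (ha : 0 < a) (p : unitInterval) :
    π.expPulls T (twoArm a p) (0 : Fin 2) = coinExp (ruleProb π T a) p T pathPulls := by
  rw [Algorithm.expPulls]
  refine (integral_law_twoArm π T ha p fun h => (pullCount (0 : Fin 2) h : ℝ)).trans ?_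
  simp only [pullCount_toHistory]

lemma variance_pullCount_twoArm (π : Algorithm) (T : ℕ) {a : ℝ} (ha : 0 < a) (p : unitInterval) :
    variance (fun h => (pullCount (0 : Fin 2) h : ℝ)) (π.law T (twoArm a p)) =
      coinExp (ruleProb π T a) p T fun h =>
        (pathPulls h - coinExp (ruleProb π T a) p T pathPulls) ^ 2 := by
  rw [variance_eq_integral (measurable_pullCount_real (0 : Fin 2)).aemeasurable]
  refine (integral_law_twoArm π T ha p _).trans ?_
  rw [← expPulls_twoArm π T ha p]
  simp only [pullCount_toHistory]
  rfl

/-! ### Bounds on pull counts, regret and variability -/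

lemma pullCount_le {K t : ℕ} (i : Fin K) (h : History K t) : pullCount i h ≤ t :=
  (Finset.card_filter_le _ _).trans_eq (by simp)

lemma integrable_pullCount {K t : ℕ} (i : Fin K) (μ : Measure (History K t)) [IsFiniteMeasure μ] :
    Integrable (fun h => (pullCount i h : ℝ)) μ :=
  Integrable.of_bound (measurable_pullCount_real i).aestronglyMeasurable (t : ℝ)
    (ae_of_all _ fun h => by simpa using pullCount_le i h)

namespace Algorithm

lemma expPulls_nonneg (π : Algorithm) (T : ℕ) (ν : Instance) (i : Fin ν.K) :
    0 ≤ π.expPulls T ν i := integral_nonneg fun _ => Nat.cast_nonneg _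

lemma sum_expPulls (π : Algorithm) (T : ℕ) (ν : Instance) (hK : 2 ≤ ν.K) :
    ∑ i, π.expPulls T ν i = T := by
  have := π.isProbabilityMeasure_law T ν hK
  unfold expPulls
  rw [← integral_finsetSum _ fun i _ => integrable_pullCount i _]
  have hsum : ∀ h : History ν.K T, ∑ i, (pullCount i h : ℝ) = T := fun h => by
    have := Finset.card_eq_sum_card_fiberwise (f := fun s => (h s).1) (s := Finset.univ)
      (t := Finset.univ) (by simp)
    rw [Finset.card_univ, Fintype.card_fin] at this
    exact_mod_cast this.symm
  simp [hsum]

/-- Boundedness is what makes the real-valued `sSup` a true upper bound, instead of its default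
value `0`. -/
lemma bddAbove_regret (π : Algorithm) (T : ℕ) (M σ : ℝ) (Kbar : ℕ) :
    BddAbove (π.regret T '' subGaussianClass M σ Kbar) := by
  refine ⟨2 * M * T, ?_⟩
  rintro _ ⟨ν, ⟨hK, -, hν⟩, rfl⟩
  rw [← π.sum_expPulls T ν hK, Finset.mul_sum]
  have : Nonempty (Fin ν.K) := ⟨⟨0, by omega⟩⟩
  refine Finset.sum_le_sum fun i _ => mul_le_mul_of_nonneg_right ?_ (π.expPulls_nonneg T ν i)
  have hsup : ⨆ j, ν.mean j ≤ M := ciSup_le fun j => (hν j).1.2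
  have := (hν i).1.1
  unfold Instance.gap
  linarith

lemma bddAbove_allocVar (π : Algorithm) (T : ℕ) (M σ : ℝ) (Kbar : ℕ) :
    BddAbove (π.allocVar T '' subGaussianClass M σ Kbar) := by
  refine ⟨T, ?_⟩
  rintro _ ⟨ν, ⟨hK, -, -⟩, rfl⟩
  have := π.isProbabilityMeasure_law T ν hK
  refine Real.iSup_le (fun i => ?_) (Nat.cast_nonneg T)
  refine Real.sqrt_le_iff.2 ⟨Nat.cast_nonneg T, ?_⟩
  have hle := variance_le_sq_of_bounded (μ := π.law T ν) (a := 0) (b := (T : ℝ))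
    (X := fun h => (pullCount i h : ℝ))
    (ae_of_all _ fun h => ⟨Nat.cast_nonneg _, by exact_mod_cast pullCount_le i h⟩)
    (measurable_pullCount_real i).aemeasurable
  refine hle.trans ?_
  nlinarith [sq_nonneg (T : ℝ)]

lemma worstAllocVar_nonneg (π : Algorithm) (P : Set Instance) (T : ℕ) :
    0 ≤ π.worstAllocVar P T := by
  refine Real.sSup_nonneg ?_
  rintro _ ⟨ν, -, rfl⟩
  exact Real.iSup_nonneg fun i => Real.sqrt_nonneg _

lemma variance_le_worstAllocVar_sq (π : Algorithm) (T : ℕ) {M σ : ℝ} {Kbar : ℕ} {ν : Instance}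
    (hν : ν ∈ subGaussianClass M σ Kbar) (i : Fin ν.K) :
    variance (fun h => (pullCount i h : ℝ)) (π.law T ν) ≤
      π.worstAllocVar (subGaussianClass M σ Kbar) T ^ 2 := by
  rw [← Real.sqrt_le_left (π.worstAllocVar_nonneg _ T)]
  exact (le_ciSup (Set.finite_range _).bddAbove i).trans
    (le_csSup (π.bddAbove_allocVar T M σ Kbar) ⟨ν, hν, rfl⟩)

end Algorithm

/-! ### Coin bandits in the sub-Gaussian class and their regret -/

lemma integral_coinArm (a : ℝ) (p : unitInterval) :
    ∫ y, y ∂(coinArm a p : Measure ℝ) = (2 * p - 1) * a := by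
  refine (integral_bernoulliMeasure a (-a) p fun y => y).trans ?_
  simp only [smul_eq_mul]
  ring

/-- Hoeffding's lemma: an interval of length `2 a` gives the variance proxy `a ^ 2 ≤ σ ^ 2`. -/
lemma hasSubgaussianMGF_coinArm {a σ : ℝ} (ha : 0 < a) (haσ : a ≤ σ) (p : unitInterval) :
    HasSubgaussianMGF (fun y : ℝ => y - ∫ y, y ∂(coinArm a p : Measure ℝ))
      (Real.toNNReal (σ ^ 2)) (coinArm a p : Measure ℝ) := by
  have hmem : ∀ᵐ y ∂(coinArm a p : Measure ℝ), y ∈ Set.Icc (-a) a := by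
    have hcompl : bernoulliMeasure a (-a) p (Set.Icc (-a) a)ᶜ = 0 :=
      bernoulliMeasure_apply_of_notMem_of_notMem p measurableSet_Icc.compl
        (by simp; linarith) (by simp; linarith)
    exact hcompl
  have h := hasSubgaussianMGF_of_mem_Icc (X := fun y : ℝ => y) aemeasurable_id hmem
  refine ⟨h.integrable_exp_mul, fun t => (h.mgf_le t).trans (Real.exp_le_exp.2 ?_)⟩
  have hc : (((‖a - -a‖₊ / 2) ^ 2 : NNReal) : ℝ) = a ^ 2 := by
    push_cast
    rw [Real.norm_eq_abs, div_pow, sq_abs]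
    ring
  rw [hc, Real.coe_toNNReal _ (sq_nonneg σ)]
  gcongr

lemma twoArm_mem_subGaussianClass {a M σ : ℝ} {Kbar : ℕ} (hK : 2 ≤ Kbar) (ha : 0 < a)
    (haM : a ≤ M) (haσ : a ≤ σ) (p : unitInterval) : twoArm a p ∈ subGaussianClass M σ Kbar := by
  have hmean : ∀ q : unitInterval, ∫ y, y ∂(coinArm a q : Measure ℝ) ∈ Set.Icc (-M) M := fun q => by
    rw [integral_coinArm]
    have := q.2.1
    have := q.2.2
    constructor <;> nlinarith
  refine ⟨le_rfl, hK, fun i => ?_⟩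
  change Fin 2 at i
  fin_cases i
  · exact ⟨hmean p, hasSubgaussianMGF_coinArm ha haσ p⟩
  · exact ⟨hmean unitHalf, hasSubgaussianMGF_coinArm ha haσ unitHalf⟩

lemma le_regret_twoArm (π : Algorithm) (T : ℕ) (a : ℝ) (p : unitInterval) :
    (1 - 2 * p) * a * π.expPulls T (twoArm a p) (0 : Fin 2) ≤ π.regret T (twoArm a p) := by
  have hle : ∀ i : Fin 2, (twoArm a p).mean i ≤ ⨆ j, (twoArm a p).mean j :=
    le_ciSup (Set.finite_range _).bddAbove
  have h0 : (twoArm a p).mean (0 : Fin 2) = (2 * p - 1) * a := integral_coinArm a p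
  have h1 : (twoArm a p).mean (1 : Fin 2) = 0 :=
    (integral_coinArm a unitHalf).trans (by norm_num [unitHalf])
  have hsum : π.regret T (twoArm a p) =
      (twoArm a p).gap (0 : Fin 2) * π.expPulls T (twoArm a p) (0 : Fin 2) +
      (twoArm a p).gap (1 : Fin 2) * π.expPulls T (twoArm a p) (1 : Fin 2) :=
    Fin.sum_univ_two _
  have hg0 : (1 - 2 * p) * a ≤ (twoArm a p).gap (0 : Fin 2) := by
    have := hle 1
    unfold Instance.gap
    linarith
  have hg1 : 0 ≤ (twoArm a p).gap (1 : Fin 2) := sub_nonneg.2 (hle 1)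
  rw [hsum]
  have := mul_le_mul_of_nonneg_right hg0 (π.expPulls_nonneg T (twoArm a p) (0 : Fin 2))
  have := mul_nonneg hg1 (π.expPulls_nonneg T (twoArm a p) (1 : Fin 2))
  linarith

/-- A horizon by which the worst-case regret is small, relative to the gap `2 δ a`, forces an
allocation variability of order `√T / δ`. -/
lemma Algorithm.IsRegular.sqrt_le_worstAllocVar {π : Algorithm} {a M σ δ : ℝ} {Kbar T : ℕ}
    (hreg : π.IsRegular (subGaussianClass M σ Kbar)) (hK : 2 ≤ Kbar) (ha : 0 < a) (haM : a ≤ M)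
    (haσ : a ≤ σ) (hδ : 0 < δ) (hδ' : δ ≤ 1 / 4) (hT : 2 ≤ T)
    (hR : π.worstRegret (subGaussianClass M σ Kbar) T ≤ a * δ / 4 * T) :
    √(T / 8) ≤ 2 * π.worstAllocVar (subGaussianClass M σ Kbar) T * δ := by
  have hmem := twoArm_mem_subGaussianClass (M := M) (σ := σ) hK ha haM haσ
  have hI : ∀ p ∈ Set.Icc (1 / 2 - δ) (1 / 2), p ∈ unitInterval := fun p hp =>
    ⟨by linarith [hp.1], by linarith [hp.2]⟩
  -- With two fair coins the arms have equal laws, so they share the `T` pulls equally in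
  -- expectation.
  have hhalf : coinExp (ruleProb π T a) (1 / 2) T pathPulls = T / 2 := by
    have hsym := hreg.symm _ (hmem unitHalf) T (0 : Fin 2) (1 : Fin 2) rfl
    have hsum : π.expPulls T (twoArm a unitHalf) (0 : Fin 2) +
        π.expPulls T (twoArm a unitHalf) (1 : Fin 2) = T :=
      (Fin.sum_univ_two _).symm.trans (π.sum_expPulls T (twoArm a unitHalf) le_rfl)
    have hexp : π.expPulls T (twoArm a unitHalf) (0 : Fin 2) =
        coinExp (ruleProb π T a) (1 / 2) T pathPulls := expPulls_twoArm π T ha unitHalf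
    linarith
  -- The gap gives `2 a δ f ≤ a δ T / 4`.
  have hsmall : coinExp (ruleProb π T a) (1 / 2 - δ) T pathPulls ≤ T / 8 := by
    let p : unitInterval := ⟨1 / 2 - δ, hI _ ⟨le_rfl, by linarith⟩⟩
    have hexp : π.expPulls T (twoArm a p) (0 : Fin 2) =
        coinExp (ruleProb π T a) (1 / 2 - δ) T pathPulls := expPulls_twoArm π T ha p
    have hle := (le_regret_twoArm π T a p).trans
      (le_csSup (π.bddAbove_regret T M σ Kbar) ⟨_, hmem p, rfl⟩)
    rw [hexp] at hle
    have hp : (1 - 2 * (p : ℝ)) * a = 2 * (a * δ) := by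
      change (1 - 2 * (1 / 2 - δ)) * a = _
      ring
    rw [hp] at hle
    have haδ : 0 < a * δ := mul_pos ha hδ
    have := hle.trans hR
    refine le_of_mul_le_mul_left ?_ haδ
    linarith
  have hmain := sqrt_coinExp_sub_le (ruleProb_nonneg π T a) (sum_ruleProb π T a) hδ.le hδ'
    (π.worstAllocVar_nonneg (subGaussianClass M σ Kbar) T) T
    (fun p hp => by
      have hexp := expPulls_twoArm π T ha ⟨p, hI p hp⟩
      have := hreg.one_le _ (hmem ⟨p, hI p hp⟩) T hT (0 : Fin 2)
      rw [hexp] at this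
      exact one_pos.trans_le this)
    (fun p hp => by
      have hvar := variance_pullCount_twoArm π T ha ⟨p, hI p hp⟩
      rw [← hvar]
      exact π.variance_le_worstAllocVar_sq T (hmem ⟨p, hI p hp⟩) (0 : Fin 2))
  -- The endpoint values of `√f` differ by at least `2 √(T / 8) - √(T / 8)`.
  have hsqrt : √((T : ℝ) / 2) = 2 * √((T : ℝ) / 8) := by
    rw [show (T : ℝ) / 2 = 2 ^ 2 * (T / 8) by ring, Real.sqrt_mul (by norm_num),
      Real.sqrt_sq (by norm_num)]
  rw [hhalf, hsqrt] at hmain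
  linarith [Real.sqrt_le_sqrt hsmall]

end Bandit

end

theorem corollary2 (M σ : ℝ) (hM : 0 < M) (hσ : 0 < σ) (Kbar : ℕ) (hK : 2 ≤ Kbar)
    (π : Bandit.Algorithm)
    (hreg : π.IsRegular (Bandit.subGaussianClass M σ Kbar))
    (hlearn : π.IsActiveLearning (Bandit.subGaussianClass M σ Kbar)) :
    Tendsto (fun T : ℕ => π.worstAllocVar (Bandit.subGaussianClass M σ Kbar) T / √(T : ℝ))
      atTop atTop := by
  have ha : 0 < min M σ := lt_min hM hσ
  refine tendsto_atTop.2 fun b => ?_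
  -- Raising the target `b` to at least `1` makes `δ` positive and at most `1 / 6`.
  have hB : 1 ≤ max b 1 := le_max_right b 1
  set B := max b 1 with hBdef
  have hB0 : 0 < B := one_pos.trans_le hB
  -- Chosen so that `√T ≤ 3 √(T / 8) ≤ 6 S δ = S / B`.
  set δ := 1 / (6 * B) with hδdef
  have hδ : 0 < δ := by positivity
  have hδ' : δ ≤ 1 / 4 := one_div_le_one_div_of_le (by norm_num) (by linarith)
  have hBδ : B * δ = 1 / 6 := by
    rw [hδdef]
    field_simp
  filter_upwards [hlearn.eventually_le_const (show 0 < min M σ * δ / 4 by positivity),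
    eventually_ge_atTop 2] with T hR hT
  have hT0 : (0 : ℝ) < T := by exact_mod_cast two_pos.trans_le hT
  rw [div_le_iff₀ hT0] at hR
  have hS := hreg.sqrt_le_worstAllocVar hK ha (min_le_left M σ) (min_le_right M σ) hδ hδ' hT hR
  set S := π.worstAllocVar (Bandit.subGaussianClass M σ Kbar) T
  have hsqrt : √(T : ℝ) ≤ 3 * √((T : ℝ) / 8) := by
    rw [show (3 : ℝ) * √((T : ℝ) / 8) = √(9 * (T / 8)) by
      rw [Real.sqrt_mul (by norm_num), show (9 : ℝ) = 3 ^ 2 by norm_num,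
        Real.sqrt_sq (by norm_num)]]
    exact Real.sqrt_le_sqrt (by linarith)
  rw [le_div_iff₀ (Real.sqrt_pos.2 hT0)]
  calc b * √(T : ℝ) ≤ B * √(T : ℝ) :=
        mul_le_mul_of_nonneg_right (le_max_left b 1) (Real.sqrt_nonneg _)
    _ ≤ B * (3 * (2 * S * δ)) :=
        mul_le_mul_of_nonneg_left (hsqrt.trans (by linarith)) hB0.le
    _ = 6 * S * (B * δ) := by ring
    _ = S := by
        rw [hBδ]
        ring
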